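/- **Conventions.** A partial Boolean function is a map $f:\mathrm{Dom}(f)\to\{-1,1\}$ with $\emptyset\ne\mathrm{Dom}(f)\subseteq\{-1,1\}^n$; bits and signs are identified by $0\leftrightarrow 1$, $1\leftrightarrow -1$. * $\mathrm D(f)$ is the least depth of a deterministic decision tree that outputs $f(x)$ for every $x\in\mathrm{Dom}(f)$. $\mathrm Q(f)$ is the least number $q$ of oracle calls in a quantum query algorithm $U_qOU_{q-1}O\cdots OU_0$, with $O|i,b,z\rangle=|i,b\oplus x_i,z\rangle$, which outputs $f(x)$ with probability at least $2/3$ for every $x\in\mathrm{Dom}(f)$. * $\widetilde{\deg}(f)$ is the least degree of a real polynomial $p$ with $|p(x)-f(x)|\le \frac13$ for $x\in\mathrm{Dom}(f)$ and $p(x)\in[-1,1]$ for all $x\in\{-1,1\}^n$. $\mathcal P_{n,d}(f)$ is the set of multilinear real polynomials $p$ in $n$ variables of degree at most $d$ with $|p(x)-f(x)|\le\frac13$ for all $x\in\mathrm{Dom}(f)$. * With $\hat p(S)=2^{-n}\sum_{x\in\{-1,1\}^n}p(x)\prod_{j\in S}x_j$, put $\mathrm{Inf}_i(p)=\sum_{S\ni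 i}\hat p(S)^2$ and $\mathrm{spar}_i(p)=|\{S\ni i:\hat p(S)\neq0\}|$. * $r(f)=\max_{y\in\{-1,1\}^n}\min_{x\in\mathrm{Dom}(f)}d_H(x,y)$ is the covering radius of the domain ($d_H$ is Hamming distance), and for $c\ge 0$ $$\eta(f,c)=\frac{\frac23-\widetilde{\deg}(f)^{-c}}{r(f)},$$ with $\eta(f,c)=+\infty$ if $r(f)=0$ (that is, if $f$ is total). If $\widetilde{\deg}(f)=0$, which happens only for constant $f$, then $0^{-c}$ is read as $0$ for $c>0$ and as $1$ for $c=0$. **Theorem.** For every constant $c\ge0$ there are constants $K,k\in\mathbb N$, depending only on $c$, such that the following holds for every $n$ and every partial Boolean function $f$ on $n$ bits with nonempty domain. Let $d=\widetilde{\deg}(f)$, and suppose that some $p\in\mathcal P_{n,d}(f)$ satisfies $$\sqrt{\mathrm{spar}_i(p)\,\mathrm{Inf}_i(p)}\le\frac{\eta(f,c)}{2}\qquad\text{for all } i\in[n].$$ Then $\mathrm D(f)=_{\mathrm{poly}}\mathrm Q(f)$, that is, $$\mathrm D(f)\le K\,\mathrm Q(f)^k\quad\text{and}\quad \mathrm Q(f)\le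 K\,\mathrm D(f)^k .$$ -/

import Mathlib

noncomputable section

namespace QueryComplexity

/-- Inputs are bit strings; `sgn` passes to the `{-1, 1}` picture. -/
abbrev Cube (n : ℕ) : Type := Fin n → Bool

/-- The encoding of a bit as a sign: `0 ↦ 1`, `1 ↦ -1`. -/
def sgn (b : Bool) : ℝ := if b then -1 else 1

/-- A partial Boolean function: `f x = none` means that `x` is outside the domain. -/
abbrev PartialFn (n : ℕ) : Type := Cube n → Option Bool

/-- The domain (promise) of a partial Boolean function. -/
def Dom {n : ℕ} (f : PartialFn n) : Set (Cube n) := {x | ∃ b, f x = some b}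

/-! ### Deterministic query complexity -/

/-- Deterministic decision trees on `n` input bits. -/
inductive DecisionTree (n : ℕ) : Type
  | leaf (b : Bool) : DecisionTree n
  | node (i : Fin n) (left right : DecisionTree n) : DecisionTree n

/-- The output of a decision tree: go left if the queried bit is `0`, right if it is `1`. -/
def DecisionTree.eval {n : ℕ} : DecisionTree n → Cube n → Bool
  | .leaf b, _ => b
  | .node i l r, x => if x i then r.eval x else l.eval x

/-- The depth of a decision tree, that is, its worst-case number of queries. -/
def DecisionTree.depth {n : ℕ} : DecisionTree n → ℕ
  | .leaf _ => 0
  | .node _ l r => max l.depth r.depth + 1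

/-- `D(f)`: the least depth of a decision tree that is correct on the domain of `f`. -/
def detQuery (n : ℕ) (f : PartialFn n) : ℕ :=
  sInf {d | ∃ T : DecisionTree n, T.depth = d ∧ ∀ x b, f x = some b → T.eval x = b}

/-! ### Bounded-error quantum query complexity -/

/-- Computational basis states `|i, b, z⟩`: an index register of `⌈log₂ n⌉` qubits, a target
qubit, and a workspace of `w` qubits. -/
abbrev BasisState (n w : ℕ) : Type := Fin (2 ^ Nat.clog 2 n) × Bool × (Fin w → Bool)

/-- The input bit addressed by the index register; unused addresses read the bit `0`. -/
def inputBit {n : ℕ} (x : Cube n) (i : Fin (2 ^ Nat.clog 2 n)) : Bool :=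
  if h : (i : ℕ) < n then x ⟨i, h⟩ else false

/-- The oracle `|i, b, z⟩ ↦ |i, b ⊕ xᵢ, z⟩`, extended linearly (written on amplitudes; this
permutation of the basis states is its own inverse). -/
def oracle {n w : ℕ} (x : Cube n) (ψ : BasisState n w → ℂ) : BasisState n w → ℂ :=
  fun s => ψ (s.1, xor s.2.1 (inputBit x s.1), s.2.2)

/-- The initial state `|0…0⟩`. -/
def initState (n w : ℕ) : BasisState n w → ℂ :=
  fun s => if s.1.val = 0 ∧ s.2.1 = false ∧ s.2.2 = (fun _ => false) then 1 else 0

/-- The state `U_q O U_{q-1} O ⋯ O U_1 O U_0 |0…0⟩` on input `x`. -/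
def runState {n w : ℕ} (U : ℕ → Matrix.unitaryGroup (BasisState n w) ℂ) (x : Cube n) :
    ℕ → BasisState n w → ℂ
  | 0 => Matrix.mulVec (U 0 : Matrix (BasisState n w) (BasisState n w) ℂ) (initState n w)
  | q + 1 => Matrix.mulVec (U (q + 1) : Matrix (BasisState n w) (BasisState n w) ℂ)
      (oracle x (runState U x q))

/-- The probability that measuring the target qubit of `ψ` gives `b`. (Which qubit is measured
is immaterial, since the last unitary of an algorithm is arbitrary.) -/
def outputProb {n w : ℕ} (ψ : BasisState n w → ℂ) (b : Bool) : ℝ :=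
  ∑ s : BasisState n w, if s.2.1 = b then ‖ψ s‖ ^ 2 else 0

/-- `Q(f)`: the least number of queries of a quantum query algorithm that outputs `f x` with
probability at least `2/3` for every `x` in the domain of `f`. -/
def quantumQuery (n : ℕ) (f : PartialFn n) : ℕ :=
  sInf {q | ∃ (w : ℕ) (U : ℕ → Matrix.unitaryGroup (BasisState n w) ℂ),
    ∀ x b, f x = some b → 2 / 3 ≤ outputProb (runState U x q) b}

/-! ### Polynomials on the cube, approximate degree -/

/-- The value of a real polynomial at a point of `{-1, 1}ⁿ`. -/
def evalCube {n : ℕ} (p : MvPolynomial (Fin n) ℝ) (x : Cube n) : ℝ :=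
  MvPolynomial.eval (fun i => sgn (x i)) p

/-- `p` approximates `f`, as a `{-1, 1}`-valued function, up to error `1/3` on its domain. -/
def Approximates {n : ℕ} (p : MvPolynomial (Fin n) ℝ) (f : PartialFn n) : Prop :=
  ∀ x b, f x = some b → |evalCube p x - sgn b| ≤ 1 / 3

/-- The approximate degree of `f`: the least degree of a real polynomial that approximates `f`
up to error `1/3` on its domain and takes values in `[-1, 1]` on the whole cube. -/
def approxDegree {n : ℕ} (f : PartialFn n) : ℕ :=
  sInf {d | ∃ p : MvPolynomial (Fin n) ℝ, p.totalDegree = d ∧ Approximates p f ∧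
    ∀ x, |evalCube p x| ≤ 1}

/-- The multilinear polynomials of degree at most `d` in `n` variables that approximate `f` up
to error `1/3`. -/
def approxPolys {n : ℕ} (d : ℕ) (f : PartialFn n) : Set (MvPolynomial (Fin n) ℝ) :=
  {p | (∀ i, p.degreeOf i ≤ 1) ∧ p.totalDegree ≤ d ∧ Approximates p f}

/-! ### Fourier coefficients, influence, sparsity -/

/-- The character `χ_S(x) = ∏_{i ∈ S} xᵢ` of `{-1, 1}ⁿ`. -/
def chi {n : ℕ} (S : Finset (Fin n)) (x : Cube n) : ℝ := ∏ i ∈ S, sgn (x i)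

/-- The Fourier coefficient `ĝ(S) = 𝔼ₓ[g(x) χ_S(x)]` for uniform `x`. -/
def fourierCoeff {n : ℕ} (g : Cube n → ℝ) (S : Finset (Fin n)) : ℝ :=
  (∑ x : Cube n, g x * chi S x) / 2 ^ n

/-- The influence `Inf_i(g) = ∑_{S ∋ i} ĝ(S)²`. -/
def influence {n : ℕ} (i : Fin n) (g : Cube n → ℝ) : ℝ :=
  ∑ S : Finset (Fin n) with i ∈ S, fourierCoeff g S ^ 2

/-- The sparsity `spar_i(g)`: the number of sets `S ∋ i` with `ĝ(S) ≠ 0`. -/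
def sparsity {n : ℕ} (i : Fin n) (g : Cube n → ℝ) : ℕ :=
  Set.ncard {S : Finset (Fin n) | i ∈ S ∧ fourierCoeff g S ≠ 0}

/-! ### Covering radius and the smoothness threshold -/

/-- The covering radius of a (nonempty) set `X`: the maximum over all points `y` of the cube of
the Hamming distance from `y` to `X`. -/
def coveringRadius {n : ℕ} (X : Set (Cube n)) : ℕ :=
  ⨆ y : Cube n, ⨅ x : X, hammingDist y (x : Cube n)

/-- The threshold `η(f, c) = (2/3 - d⁻ᶜ) / r`, with `d` the approximate degree of `f` and `r` the
covering radius of its domain; it is `+∞` when `r = 0`, that is, when `f` is total. -/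
def eta {n : ℕ} (f : PartialFn n) (c : ℝ) : EReal :=
  if coveringRadius (Dom f) = 0 then ⊤
  else (((2 / 3 - (approxDegree f : ℝ) ^ (-c)) / (coveringRadius (Dom f) : ℝ) : ℝ) : EReal)

/-- `f` has an approximating polynomial of degree `d = approxDegree f` with
`√(spar_i(p) · Inf_i(p)) ≤ η(f, c) / 2` for all `i`. -/
def LowInfluence {n : ℕ} (f : PartialFn n) (c : ℝ) : Prop :=
  ∃ p ∈ approxPolys (approxDegree f) f, ∀ i : Fin n,
    ((√((sparsity i (evalCube p) : ℝ) * influence i (evalCube p)) : ℝ) : EReal) ≤ eta f c / 2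

/-! ### Polynomial relation -/

/-- The measures `A` and `B` are polynomially related on the class `C` of partial functions: each
is bounded by a fixed polynomial in the other, uniformly over `n` and over the class. -/
def PolyRelatedOn (C : ∀ n, Set (PartialFn n)) (A B : ∀ n, PartialFn n → ℕ) : Prop :=
  ∃ K k : ℕ, ∀ n, ∀ f ∈ C n, A n f ≤ K * B n f ^ k ∧ B n f ≤ K * A n f ^ k

end QueryComplexity

end

noncomputable section

namespace QueryComplexity

/-! ### Decision trees from certificates -/

/-! Write d for the approximate degree. The theorem follows from D(f) ≤ poly(d), d ≤ 54 Q(f) and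
Q(f) ≤ D(f).

The low-influence hypothesis matters only for the first bound: it keeps p away from 0 even off the
domain. By Fourier inversion and Cauchy–Schwarz, negating bit i changes p by at most 2√(spar_i
Inf_i) ≤ η (`abs_sub_le_of_eq_off`). If r > 0, every point is within r negations of the domain,
where 2/3 ≤ |p| ≤ 4/3, so |p| ≥ 2/3 - rη = d⁻ᶜ and |p| ≤ 2 on the whole cube; total f is immediate
(`LowInfluence.exists_gap`). Hence the sign of p is a total function extending f. Disjoint blocks
that change this sign at x all move p in the same direction, each by at least twice the gap, while
Markov's inequality bounds the total movement by O(d²). So block sensitivity is polynomial in d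
(`blockSensitivityLE_signFn`), and a decision tree of depth bs⁴ is built from certificates
(`BlockSensitivityLE.exists_tree`).

The second bound is the polynomial method followed by amplification of the bias
(`approxDegree_le_of_algorithm`). The third runs a decision tree reversibly by storing all answers
(`DecisionTree.exists_algorithm`). -/

/-- A point obtained from `x` by negating the bits in `S`. -/
def flip {n : ℕ} (x : Cube n) (S : Finset (Fin n)) : Cube n :=
  fun i => if i ∈ S then !x i else x i

/-- The value of `F` at `x` is determined by the bits of `x` in `S`. -/
def Certifies {n : ℕ} (F : Cube n → Bool) (x : Cube n) (S : Finset (Fin n)) : Prop :=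
  ∀ y, (∀ i ∈ S, y i = x i) → F y = F x

/-- Query all the bits in `S`, then continue with a tree that may depend on the answers. -/
lemma exists_tree_of_query {n : ℕ} (F : Cube n → Bool) (e : ℕ) (S : Finset (Fin n)) :
    ∀ (Q : Finset (Fin n)) (a : Cube n),
      (∀ a' : Cube n, (∀ i ∈ Q, a' i = a i) → ∃ T : DecisionTree n, T.depth ≤ e ∧
        ∀ x, (∀ i ∈ Q ∪ S, x i = a' i) → T.eval x = F x) →
      ∃ T : DecisionTree n, T.depth ≤ S.card + e ∧
        ∀ x, (∀ i ∈ Q, x i = a i) → T.eval x = F x := by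
  induction S using Finset.induction_on with
  | empty =>
    intro Q a h
    obtain ⟨T, hT, hx⟩ := h a fun _ _ => rfl
    exact ⟨T, by simpa using hT, fun x hx' => hx x (by simpa using hx')⟩
  | insert j S hj ih =>
    intro Q a h
    have key : ∀ b : Bool, ∃ T : DecisionTree n, T.depth ≤ S.card + e ∧
        ∀ x, (∀ i ∈ Q, x i = a i) → x j = b → T.eval x = F x := by
      intro b
      by_cases hb : ∃ x : Cube n, (∀ i ∈ Q, x i = a i) ∧ x j = b
      · obtain ⟨a₀, h₀, h₁⟩ := hb
        obtain ⟨T, hT, hx⟩ := ih (insert j Q) a₀ (by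
          intro a' ha'
          obtain ⟨T, hT, hx⟩ := h a' (fun i hi => by
            rw [ha' i (Finset.mem_insert_of_mem hi), h₀ i hi])
          refine ⟨T, hT, fun x hx' => hx x fun i hi => hx' i ?_⟩
          simp only [Finset.mem_union, Finset.mem_insert] at hi ⊢
          tauto)
        refine ⟨T, hT, fun x hx' hxj => hx x fun i hi => ?_⟩
        rcases Finset.mem_insert.1 hi with rfl | hi
        · rw [hxj, h₁]
        · rw [hx' i hi, h₀ i hi]
      -- This answer is impossible: `j` already lies in `Q` and `a` gives it the other value. Any
      -- tree will do.
      · exact ⟨.leaf false, by simp [DecisionTree.depth], fun x hx hxj => (hb ⟨x, hx, hxj⟩).elim⟩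
    obtain ⟨T₀, hd₀, h₀⟩ := key false
    obtain ⟨T₁, hd₁, h₁⟩ := key true
    refine ⟨.node j T₀ T₁, ?_, fun x hx => ?_⟩
    · rw [Finset.card_insert_of_notMem hj, DecisionTree.depth]
      omega
    · cases hb : x j
      · simpa [DecisionTree.eval, hb] using h₀ x hx hb
      · simpa [DecisionTree.eval, hb] using h₁ x hx hb

/-- On a subcube, the depth is at most the product of the `0`- and `1`-certificate sizes. -/
lemma exists_tree_of_certificates_subcube {n : ℕ} (F : Cube n → Bool) (m : ℕ)
    (h1 : ∀ x, F x = true → ∃ S : Finset (Fin n), S.card ≤ m ∧ Certifies F x S) (k : ℕ) :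
    ∀ (Q : Finset (Fin n)) (a : Cube n),
      (∀ x, (∀ i ∈ Q, x i = a i) → F x = false →
        ∃ S : Finset (Fin n), S.card ≤ k ∧ Certifies F x (S ∪ Q)) →
      ∃ T : DecisionTree n, T.depth ≤ k * m ∧ ∀ x, (∀ i ∈ Q, x i = a i) → T.eval x = F x := by
  induction k with
  | zero =>
    intro Q a h
    by_cases hf : ∃ x, (∀ i ∈ Q, x i = a i) ∧ F x = false
    · obtain ⟨x, hx, hFx⟩ := hf
      obtain ⟨S, hS, hc⟩ := h x hx hFx
      obtain rfl : S = ∅ := Finset.card_eq_zero.1 (by omega)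
      refine ⟨.leaf false, by simp [DecisionTree.depth], fun y hy => ?_⟩
      rw [hc y fun i hi => ?_, hFx]
      · rfl
      · have hi : i ∈ Q := by simpa using hi
        rw [hy i hi, hx i hi]
    · refine ⟨.leaf true, by simp [DecisionTree.depth], fun y hy => ?_⟩
      have : F y ≠ false := fun h => hf ⟨y, hy, h⟩
      simpa [DecisionTree.eval] using this
  | succ k ih =>
    intro Q a h
    by_cases hf : ∃ x, (∀ i ∈ Q, x i = a i) ∧ F x = true
    · obtain ⟨x, hx, hFx⟩ := hf
      obtain ⟨S, hS, hc⟩ := h1 x hFx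
      obtain ⟨T, hT, hTx⟩ := exists_tree_of_query F (k * m) S Q a (by
        intro a' ha'
        refine ih (Q ∪ S) a' fun y hy hFy => ?_
        have hyQ : ∀ i ∈ Q, y i = a i := fun i hi => by
          rw [hy i (Finset.mem_union_left _ hi), ha' i hi]
        obtain ⟨R, hR, hcR⟩ := h y hyQ hFy
        -- The certificates of `x` and `y` must share a bit, for otherwise the hybrid `z` satisfies
        -- both of them. Querying `S` therefore shortens every remaining `0`-certificate by at least
        -- one.
        obtain ⟨j, hjR, hjS⟩ : ∃ j ∈ R, j ∈ S := by
          by_contra hne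
          push Not at hne
          let z : Cube n := fun i => if i ∈ S then x i else y i
          have hz1 : F z = F x := hc z fun i hi => by simp [z, hi]
          have hz2 : F z = F y := hcR z fun i hi => by
            by_cases hiS : i ∈ S
            · have hiQ : i ∈ Q := by
                rcases Finset.mem_union.1 hi with hi | hi
                · exact (hne i hi hiS).elim
                · exact hi
              simp [z, hiS, hx i hiQ, hyQ i hiQ]
            · simp [z, hiS]
          rw [hz1, hFx, hFy] at hz2
          cases hz2
        refine ⟨R.erase j, by rw [Finset.card_erase_of_mem hjR]; omega, fun z hz => hcR z ?_⟩
        intro i hi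
        refine hz i ?_
        simp only [Finset.mem_union, Finset.mem_erase] at hi ⊢
        by_cases hij : i = j
        · exact .inr (.inr (hij ▸ hjS))
        · tauto)
      refine ⟨T, hT.trans ?_, hTx⟩
      rw [Nat.succ_mul]
      omega
    · refine ⟨.leaf false, by simp [DecisionTree.depth], fun y hy => ?_⟩
      have : F y ≠ true := fun h => hf ⟨y, hy, h⟩
      simpa [DecisionTree.eval] using this.symm

lemma exists_tree_of_certificates {n : ℕ} (F : Cube n → Bool) (m : ℕ)
    (h : ∀ x, ∃ S : Finset (Fin n), S.card ≤ m ∧ Certifies F x S) :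
    ∃ T : DecisionTree n, T.depth ≤ m * m ∧ ∀ x, T.eval x = F x := by
  obtain ⟨T, hT, hx⟩ := exists_tree_of_certificates_subcube F m (fun x _ => h x) m ∅
    (fun _ => false) (fun x _ _ => by simpa using h x)
  exact ⟨T, hT, fun x => hx x (by simp)⟩

/-! ### Certificates from block sensitivity -/

lemma flip_empty {n : ℕ} (x : Cube n) : flip x ∅ = x := by
  funext i; simp [flip]

/-- The block sensitivity of `F` is at most `B`. -/
def BlockSensitivityLE {n : ℕ} (F : Cube n → Bool) (B : ℕ) : Prop :=
  ∀ (x : Cube n) (𝓑 : Finset (Finset (Fin n))), (𝓑 : Set (Finset (Fin n))).PairwiseDisjoint id →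
    (∀ S ∈ 𝓑, F (flip x S) ≠ F x) → 𝓑.card ≤ B

/-- `S` is a minimal block to which `F` is sensitive at `x`. -/
def MinimalBlock {n : ℕ} (F : Cube n → Bool) (x : Cube n) (S : Finset (Fin n)) : Prop :=
  Minimal (fun S => F (flip x S) ≠ F x) S

/-- After `S` is negated, restoring any single bit of `S` leaves a strictly smaller block, which is
not sensitive by minimality. Thus the singletons of `S` are disjoint sensitive blocks at `flip x S`.
-/
lemma BlockSensitivityLE.card_minimalBlock {n : ℕ} {F : Cube n → Bool} {B : ℕ}
    (hB : BlockSensitivityLE F B) {x : Cube n} {S : Finset (Fin n)} (hS : MinimalBlock F x S) :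
    S.card ≤ B := by
  have := hB (flip x S) (S.image fun i => {i}) ?_ ?_
  · rwa [Finset.card_image_of_injective _ Finset.singleton_injective] at this
  · intro s hs t ht hst
    simp only [Finset.coe_image, Set.mem_image] at hs ht
    obtain ⟨i, -, rfl⟩ := hs
    obtain ⟨j, -, rfl⟩ := ht
    simpa [Function.onFun] using hst
  · intro s hs
    obtain ⟨i, hi, rfl⟩ := Finset.mem_image.1 hs
    have hflip : flip (flip x S) {i} = flip x (S.erase i) := by
      funext j
      by_cases hj : j = i
      · subst hj; simp [flip, hi]
      · simp [flip, hj]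
    have : F (flip x (S.erase i)) = F x := by
      by_contra hne
      have := hS.2 hne (Finset.erase_subset i S) hi
      simp at this
    rw [hflip, this]
    exact hS.1.symm

/-- The union of a maximal family of disjoint minimal sensitive blocks is a certificate: a violating
`y` would differ from `x` on a set containing a further minimal block, disjoint from the family. -/
lemma BlockSensitivityLE.exists_certificate {n : ℕ} {F : Cube n → Bool} {B : ℕ}
    (hB : BlockSensitivityLE F B) (x : Cube n) :
    ∃ S : Finset (Fin n), S.card ≤ B * B ∧ Certifies F x S := by
  obtain ⟨𝓑, h𝓑⟩ := (Set.toFinite {𝓑 : Finset (Finset (Fin n)) |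
    (𝓑 : Set (Finset (Fin n))).PairwiseDisjoint id ∧ ∀ S ∈ 𝓑, MinimalBlock F x S}).exists_maximal
      ⟨∅, by simp⟩
  obtain ⟨hdisj, hmin⟩ := h𝓑.1
  refine ⟨𝓑.biUnion id, ?_, fun y hy => ?_⟩
  · refine (Finset.card_biUnion_le_card_mul _ _ B fun S hS => hB.card_minimalBlock (hmin S hS)).trans
      (Nat.mul_le_mul_right _ ?_)
    exact hB x 𝓑 hdisj fun S hS => (hmin S hS).1
  · by_contra hne
    let Δ : Finset (Fin n) := Finset.univ.filter fun i => y i ≠ x i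
    have hΔ : flip x Δ = y := by
      funext i
      by_cases h : y i = x i
      · simp [flip, Δ, h]
      · simp only [flip, Δ, Finset.mem_filter, Finset.mem_univ, true_and]
        cases hx : x i <;> cases hy : y i <;> simp_all
    obtain ⟨M, hMΔ, hM⟩ := exists_minimal_le_of_wellFoundedLT
      (fun S => F (flip x S) ≠ F x) Δ (by rwa [hΔ])
    have hdis : ∀ S ∈ 𝓑, Disjoint M S := by
      intro S hS
      rw [Finset.disjoint_left]
      intro i hiM hiS
      have : y i ≠ x i := by simpa [Δ] using hMΔ hiM
      exact this (hy i (Finset.mem_biUnion.2 ⟨S, hS, hiS⟩))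
    have hins : insert M 𝓑 ≤ 𝓑 := by
      refine h𝓑.2 ⟨?_, ?_⟩ (Finset.subset_insert _ _)
      · rw [Finset.coe_insert]
        exact hdisj.insert fun S hS _ => hdis S hS
      · intro S hS
        rcases Finset.mem_insert.1 hS with rfl | hS
        · exact hM
        · exact hmin S hS
    -- By maximality `M` already belongs to the family, so it is disjoint from itself, hence empty;
    -- but the empty block is never sensitive.
    have hMM := hdis M (hins (Finset.mem_insert_self _ _))
    rw [disjoint_self] at hMM
    have : F (flip x M) ≠ F x := hM.1
    rw [hMM] at this
    exact this (congrArg F (flip_empty x))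

lemma BlockSensitivityLE.exists_tree {n : ℕ} {F : Cube n → Bool} {B : ℕ}
    (hB : BlockSensitivityLE F B) :
    ∃ T : DecisionTree n, T.depth ≤ B ^ 4 ∧ ∀ x, T.eval x = F x := by
  obtain ⟨T, hT, hx⟩ := exists_tree_of_certificates F (B * B) hB.exists_certificate
  exact ⟨T, hT.trans (le_of_eq (by ring)), hx⟩

/-! ### Markov's inequality for derivatives -/

open Polynomial in
/-- Markov's inequality at an endpoint of `[0, 1]`. -/
lemma abs_derivative_eval_zero_le {G : ℝ[X]} {d : ℕ} {M : ℝ} (hM : 0 < M) (hd : G.natDegree ≤ d)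
    (hG : ∀ t ∈ Set.Icc (0 : ℝ) 1, |G.eval t| ≤ M) :
    |(derivative G).eval 0| ≤ 2 * M * d ^ 2 := by
  have key : ∀ c : ℝ, |c| = M⁻¹ → -(c * (derivative G).eval 0 / 2) ≤ (d : ℝ) ^ 2 := by
    intro c hc
    -- The substitution t = (1 - x)/2 carries [-1, 1] to [0, 1] and x = 1 to t = 0, with derivative
    -- -1/2. The extremal value is T_d'(1) = d². The two signs of `c` give the absolute value.
    have h := Chebyshev.eval_iterate_derivative_le_of_forall_abs_le_one (n := d) (k := 1) (x := 1)
      (P := C c * G.comp (C (1 / 2) - C (1 / 2) * X)) le_rfl ?_ ?_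
    · have hT := Chebyshev.derivative_T_eval_one (R := ℝ) d
      simp only [Function.iterate_one] at h
      rw [hT] at h
      simp [derivative_comp] at h
      linarith
    · refine natDegree_le_iff_degree_le.1 ((natDegree_C_mul_le _ _).trans ?_)
      refine natDegree_comp_le.trans ?_
      have : (C (1 / 2) - C (1 / 2) * X : ℝ[X]).natDegree ≤ 1 := by compute_degree
      nlinarith
    · intro x hx
      have : |G.eval (1 / 2 - 1 / 2 * x)| ≤ M :=
        hG _ ⟨by linarith [hx.2], by linarith [hx.1]⟩
      rw [eval_mul, eval_C, abs_mul, hc, eval_comp]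
      simp only [eval_sub, eval_C, eval_mul, eval_X]
      rw [inv_mul_le_iff₀ hM]
      simpa using this
  have h1 := key M⁻¹ (abs_of_pos (by positivity))
  have h2 := key (-M⁻¹) (by rw [abs_neg]; exact abs_of_pos (by positivity))
  have h3 : (M⁻¹ * (derivative G).eval 0) * M = (derivative G).eval 0 := by field_simp
  rw [abs_le]
  constructor <;> nlinarith

/-! ### Functions of low degree on the subsets of a finite set -/

section Indicators

variable {ι : Type*} [Fintype ι] [DecidableEq ι]

/-- The multilinear monomial `∏_{j ∈ S} z_j`, as a function of the set `z`. -/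
def monomialFn (S z : Finset ι) : ℝ := if S ⊆ z then 1 else 0

/-- Functions of degree at most `d`. -/
def lowDegree (ι : Type*) [Fintype ι] [DecidableEq ι] (d : ℕ) : Submodule ℝ (Finset ι → ℝ) :=
  Submodule.span ℝ (monomialFn '' {S : Finset ι | S.card ≤ d})

lemma monomialFn_mem {S : Finset ι} {d : ℕ} (h : S.card ≤ d) : monomialFn S ∈ lowDegree ι d :=
  Submodule.subset_span ⟨S, h, rfl⟩

lemma lowDegree_mono {d e : ℕ} (h : d ≤ e) : lowDegree ι d ≤ lowDegree ι e :=
  Submodule.span_mono (Set.image_mono fun _ hS => le_trans hS h)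

lemma mul_mem_lowDegree {d e : ℕ} {g h : Finset ι → ℝ} (hg : g ∈ lowDegree ι d)
    (hh : h ∈ lowDegree ι e) : g * h ∈ lowDegree ι (d + e) := by
  have := Submodule.mul_mem_mul hg hh
  rw [lowDegree, lowDegree, Submodule.span_mul_span] at this
  refine Submodule.span_mono ?_ this
  rintro _ ⟨_, ⟨S, hS, rfl⟩, _, ⟨T, hT, rfl⟩, rfl⟩
  refine ⟨S ∪ T, (Finset.card_union_le _ _).trans (add_le_add hS hT), ?_⟩
  funext z
  by_cases h1 : S ⊆ z <;> by_cases h2 : T ⊆ z <;> simp [monomialFn, Finset.union_subset_iff, h1, h2]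

lemma one_mem_lowDegree : (1 : Finset ι → ℝ) ∈ lowDegree ι 0 := by
  have := monomialFn_mem (S := (∅ : Finset ι)) (d := 0) (by simp)
  convert this using 1
  funext z
  simp [monomialFn]

lemma pow_mem_lowDegree {d : ℕ} {g : Finset ι → ℝ} (hg : g ∈ lowDegree ι d) (k : ℕ) :
    g ^ k ∈ lowDegree ι (k * d) := by
  induction k with
  | zero => simpa using one_mem_lowDegree
  | succ k ih =>
    rw [pow_succ, Nat.succ_mul]
    exact mul_mem_lowDegree ih hg

lemma prod_mem_lowDegree {κ : Type*} (s : Finset κ) (d : κ → ℕ) (g : κ → Finset ι → ℝ)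
    (hg : ∀ i ∈ s, g i ∈ lowDegree ι (d i)) : ∏ i ∈ s, g i ∈ lowDegree ι (∑ i ∈ s, d i) := by
  classical
  induction s using Finset.induction_on with
  | empty => simpa using one_mem_lowDegree
  | insert j s hj ih =>
    rw [Finset.prod_insert hj, Finset.sum_insert hj]
    exact mul_mem_lowDegree (hg j (Finset.mem_insert_self _ _))
      (ih fun i hi => hg i (Finset.mem_insert_of_mem hi))

/-- The expectation of `h` at a random set that contains each point independently with
probability `t`. -/
def biasedMean (h : Finset ι → ℝ) (t : ℝ) : ℝ :=
  ∑ z : Finset ι, h z * (t ^ z.card * (1 - t) ^ (Fintype.card ι - z.card))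

/-- Expand ∏_j (t + (1 - t)[j ∉ S]) over the set z of factors that contribute t: a term survives
exactly when S ⊆ z. -/
lemma biasedMean_monomialFn (S : Finset ι) (t : ℝ) :
    biasedMean (monomialFn S) t = t ^ S.card := by
  have h := Finset.prod_add (fun _ : ι => t) (fun j => if j ∈ S then 0 else 1 - t) Finset.univ
  have h1 : ∏ j : ι, (t + if j ∈ S then 0 else 1 - t) = t ^ S.card := by
    have : ∀ j : ι, (t + if j ∈ S then 0 else 1 - t) = if j ∈ S then t else 1 := by
      intro j; split_ifs <;> ring
    simp_rw [this]
    rw [Finset.prod_ite_mem, Finset.univ_inter, Finset.prod_const]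
  rw [← h1, h, Finset.powerset_univ, biasedMean]
  refine Finset.sum_congr rfl fun z _ => ?_
  rw [Finset.prod_const]
  by_cases hS : S ⊆ z
  · have : ∏ j ∈ Finset.univ \ z, (if j ∈ S then 0 else 1 - t) = ∏ _j ∈ Finset.univ \ z, (1 - t) :=
      Finset.prod_congr rfl fun j hj => by
        rw [if_neg fun hjS => (Finset.mem_sdiff.1 hj).2 (hS hjS)]
    rw [this, Finset.prod_const, Finset.card_univ_sdiff, monomialFn, if_pos hS, one_mul]
  · obtain ⟨j, hjS, hjz⟩ := Finset.not_subset.1 hS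
    rw [Finset.prod_eq_zero (i := j) (by simp [hjz]) (by simp [hjS]), monomialFn, if_neg hS]
    simp

lemma abs_biasedMean_le {h : Finset ι → ℝ} {M : ℝ} (hh : ∀ z, |h z| ≤ M) {t : ℝ}
    (ht : t ∈ Set.Icc (0 : ℝ) 1) : |biasedMean h t| ≤ M := by
  have h1 : ∑ z : Finset ι, t ^ z.card * (1 - t) ^ (Fintype.card ι - z.card) = 1 := by
    have := biasedMean_monomialFn (∅ : Finset ι) t
    simpa [biasedMean, monomialFn] using this
  have ht' : 0 ≤ 1 - t := by linarith [ht.2]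
  have ht0 := ht.1
  calc |biasedMean h t|
      ≤ ∑ z : Finset ι, |h z * (t ^ z.card * (1 - t) ^ (Fintype.card ι - z.card))| :=
        Finset.abs_sum_le_sum_abs _ _
    _ ≤ ∑ z : Finset ι, M * (t ^ z.card * (1 - t) ^ (Fintype.card ι - z.card)) := by
        refine Finset.sum_le_sum fun z _ => ?_
        have : 0 ≤ t ^ z.card * (1 - t) ^ (Fintype.card ι - z.card) := by positivity
        rw [abs_mul, abs_of_nonneg this]
        exact mul_le_mul_of_nonneg_right (hh z) this
    _ = M := by rw [← Finset.mul_sum, h1, mul_one]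

lemma sum_monomialFn_singleton (S : Finset ι) :
    ∑ j, (monomialFn S {j} - monomialFn S ∅) = if S.card = 1 then 1 else 0 := by
  rcases S.eq_empty_or_nonempty with rfl | hne
  · simp [monomialFn]
  · have h0 : monomialFn S ∅ = 0 := by simp [monomialFn, hne.ne_empty]
    by_cases h1 : S.card = 1
    · obtain ⟨i, rfl⟩ := Finset.card_eq_one.1 h1
      simp [monomialFn]
    · simp only [h0, sub_zero, h1, if_false]
      refine Finset.sum_eq_zero fun j _ => if_neg fun hj => h1 ?_
      have := Finset.card_le_card hj
      have := hne.card_pos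
      simp only [Finset.card_singleton] at *
      omega

open Polynomial in
-- Everything is linear in `h`, so monomials suffice, and their mean is t^|S|. The derivative at 0
-- records the total change from `∅` to singletons, which turns a question about many variables into
-- one about a single variable.
lemma exists_polynomial_biasedMean {d : ℕ} {h : Finset ι → ℝ} (hh : h ∈ lowDegree ι d) :
    ∃ G : ℝ[X], G.natDegree ≤ d ∧ (∀ t, G.eval t = biasedMean h t) ∧
      (derivative G).eval 0 = ∑ j, (h {j} - h ∅) := by
  induction hh using Submodule.span_induction with
  | mem h hS =>
    obtain ⟨S, hS, rfl⟩ := hS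
    refine ⟨X ^ S.card, (natDegree_X_pow_le _).trans hS, fun t => ?_, ?_⟩
    · rw [biasedMean_monomialFn, eval_pow, eval_X]
    · rw [sum_monomialFn_singleton, derivative_X_pow]
      rcases hc : S.card with _ | _ | k <;> simp
  | zero => exact ⟨0, by simp, by simp [biasedMean], by simp⟩
  | add g h _ _ hg hh =>
    obtain ⟨G, hG, hGe, hGd⟩ := hg
    obtain ⟨H, hH, hHe, hHd⟩ := hh
    refine ⟨G + H, natDegree_add_le_of_degree_le hG hH, fun t => ?_, ?_⟩
    · simp [hGe, hHe, biasedMean, add_mul, Finset.sum_add_distrib]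
    · rw [derivative_add, eval_add, hGd, hHd, ← Finset.sum_add_distrib]
      exact Finset.sum_congr rfl fun j _ => by simp only [Pi.add_apply]; ring
  | smul c g _ hg =>
    obtain ⟨G, hG, hGe, hGd⟩ := hg
    refine ⟨C c * G, (natDegree_C_mul_le _ _).trans hG, fun t => ?_, ?_⟩
    · simp [hGe, biasedMean, Finset.mul_sum, mul_assoc]
    · rw [derivative_C_mul, eval_mul, eval_C, hGd, Finset.mul_sum]
      exact Finset.sum_congr rfl fun j _ => by simp only [Pi.smul_apply, smul_eq_mul]; ring

/-- A bounded function of degree `d` on sets has total sensitivity at most `2 M d²` at `∅`. -/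
lemma abs_sum_singleton_sub_le {d : ℕ} {h : Finset ι → ℝ} {M : ℝ} (hM : 0 < M)
    (hh : h ∈ lowDegree ι d) (hb : ∀ z, |h z| ≤ M) : |∑ j, (h {j} - h ∅)| ≤ 2 * M * d ^ 2 := by
  obtain ⟨G, hG, hGe, hGd⟩ := exists_polynomial_biasedMean hh
  rw [← hGd]
  exact abs_derivative_eval_zero_le hM hG fun t ht => by
    rw [hGe]; exact abs_biasedMean_le hb ht

/-- Since the blocks are disjoint, each input sign is affine in at most one indicator j ∈ z, so the
substitution does not raise the degree. -/
lemma evalCube_flip_biUnion_mem_lowDegree {n : ℕ} (p : MvPolynomial (Fin n) ℝ) (x : Cube n)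
    (B : ι → Finset (Fin n)) (hB : Pairwise fun i j => Disjoint (B i) (B j)) :
    (fun z : Finset ι => evalCube p (flip x (z.biUnion B))) ∈ lowDegree ι p.totalDegree := by
  have hcoord : ∀ i, (fun z : Finset ι => sgn (flip x (z.biUnion B) i)) ∈ lowDegree ι 1 := by
    intro i
    have h1 : (1 : Finset ι → ℝ) ∈ lowDegree ι 1 := lowDegree_mono zero_le_one one_mem_lowDegree
    by_cases hi : ∃ j, i ∈ B j
    · obtain ⟨j, hj⟩ := hi
      have hiff : ∀ z : Finset ι, i ∈ z.biUnion B ↔ j ∈ z := by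
        intro z
        rw [Finset.mem_biUnion]
        refine ⟨fun ⟨k, hk, hik⟩ => ?_, fun hz => ⟨j, hz, hj⟩⟩
        by_contra hjz
        have hkj : k ≠ j := fun h => hjz (h ▸ hk)
        exact Finset.disjoint_left.1 (hB hkj) hik hj
      have : (fun z : Finset ι => sgn (flip x (z.biUnion B) i)) =
          sgn (x i) • (1 : Finset ι → ℝ) + (-2 * sgn (x i)) • monomialFn {j} := by
        funext z
        simp only [flip, hiff, Pi.add_apply, Pi.smul_apply, Pi.one_apply, monomialFn,
          Finset.singleton_subset_iff]
        by_cases hz : j ∈ z <;> cases x i <;> simp [sgn, hz] <;> norm_num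
      rw [this]
      exact add_mem (Submodule.smul_mem _ _ h1) (Submodule.smul_mem _ _ (monomialFn_mem (by simp)))
    · have : (fun z : Finset ι => sgn (flip x (z.biUnion B) i)) = sgn (x i) • 1 := by
        funext z
        have : i ∉ z.biUnion B := by
          rw [Finset.mem_biUnion]; rintro ⟨k, -, hk⟩; exact hi ⟨k, hk⟩
        simp [flip, this]
      rw [this]
      exact Submodule.smul_mem _ _ h1
  have : (fun z : Finset ι => evalCube p (flip x (z.biUnion B))) =
      ∑ m ∈ p.support, p.coeff m •
        ∏ i ∈ m.support, (fun z : Finset ι => sgn (flip x (z.biUnion B) i)) ^ m i := by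
    funext z
    simp [evalCube, MvPolynomial.eval_eq, Finset.sum_apply, Finset.prod_apply]
  rw [this]
  refine Submodule.sum_mem _ fun m hm => Submodule.smul_mem _ _ ?_
  refine lowDegree_mono (MvPolynomial.le_totalDegree hm) ?_
  refine prod_mem_lowDegree _ _ _ fun i _ => ?_
  simpa using pow_mem_lowDegree (hcoord i) (m i)

end Indicators

/-! ### Block sensitivity of the sign of a polynomial -/

/-- The total Boolean function given by the sign of `g`. -/
def signFn {n : ℕ} (g : Cube n → ℝ) (x : Cube n) : Bool := decide (g x < 0)

lemma blockSensitivityLE_signFn {n : ℕ} {p : MvPolynomial (Fin n) ℝ} {d B : ℕ} {ε : ℝ}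
    (hd : p.totalDegree ≤ d) (hε : 0 < ε) (hlow : ∀ x, ε ≤ |evalCube p x|)
    (hup : ∀ x, |evalCube p x| ≤ 2) (hB : 2 * (d : ℝ) ^ 2 ≤ B * ε) :
    BlockSensitivityLE (signFn (evalCube p)) B := by
  intro x 𝓑 hdisj hsens
  have hmem := lowDegree_mono hd (evalCube_flip_biUnion_mem_lowDegree p x
    (fun S : 𝓑 => (S : Finset (Fin n))) fun S T hST =>
      hdisj S.2 T.2 fun h => hST (Subtype.ext h))
  have hle := abs_sum_singleton_sub_le two_pos hmem fun z => hup _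
  simp only [Finset.singleton_biUnion, Finset.biUnion_empty, flip_empty] at hle
  suffices h : 𝓑.card * (2 * ε) ≤ 2 * 2 * (d : ℝ) ^ 2 by
    have : (𝓑.card : ℝ) ≤ B := le_of_mul_le_mul_right (by linarith) hε
    exact_mod_cast this
  refine le_trans ?_ hle
  have hcard : (𝓑.card : ℝ) * (2 * ε) = ∑ _S : 𝓑, 2 * ε := by simp
  rw [hcard]
  have hx := hlow x
  have hs : ∀ S : 𝓑, ¬ (evalCube p (flip x S) < 0 ↔ evalCube p x < 0) := by
    intro S h
    exact hsens S S.2 (by simp [signFn, h])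
  -- All blocks push `p` across the gap (-ε, ε) in the same direction, so the terms of the sum
  -- cannot cancel and each is at least 2ε in size.
  by_cases hneg : evalCube p x < 0
  · refine le_trans (Finset.sum_le_sum fun S _ => ?_) (le_abs_self _)
    have h1 : 0 ≤ evalCube p (flip x S) := by
      have := hs S; simp only [hneg, iff_true, not_lt] at this; exact this
    have h2 := hlow (flip x S)
    rw [abs_of_neg hneg] at hx
    rw [abs_of_nonneg h1] at h2
    linarith
  · refine le_trans ?_ (neg_le_abs _)
    rw [← Finset.sum_neg_distrib]
    refine Finset.sum_le_sum fun S _ => ?_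
    have h1 : evalCube p (flip x S) < 0 := by
      have := hs S; simp only [hneg, iff_false, not_not] at this; exact this
    have h2 := hlow (flip x S)
    rw [abs_of_nonneg (not_lt.1 hneg)] at hx
    rw [abs_of_neg h1] at h2
    linarith

/-! ### Fourier expansion and influence -/

lemma abs_chi {n : ℕ} (S : Finset (Fin n)) (x : Cube n) : |chi S x| = 1 := by
  rw [chi, Finset.abs_prod]
  exact Finset.prod_eq_one fun i _ => by cases x i <;> simp [sgn]

/-- The sum factors as ∏ᵢ (1 + xᵢyᵢ), and a coordinate where the points differ contributes 0. -/
lemma sum_chi_mul_chi {n : ℕ} (x y : Cube n) :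
    ∑ S : Finset (Fin n), chi S x * chi S y = if x = y then 2 ^ n else 0 := by
  have h := Finset.prod_one_add (f := fun i => sgn (x i) * sgn (y i)) (Finset.univ : Finset (Fin n))
  rw [Finset.powerset_univ] at h
  simp_rw [chi, ← Finset.prod_mul_distrib, ← h]
  split_ifs with hxy
  · subst hxy
    have : ∀ i, 1 + sgn (x i) * sgn (x i) = 2 := fun i => by cases x i <;> norm_num [sgn]
    simp [this]
  · obtain ⟨i, hi⟩ := Function.ne_iff.1 hxy
    refine Finset.prod_eq_zero (Finset.mem_univ i) ?_
    cases hx : x i <;> cases hy : y i <;> simp_all [sgn]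

lemma sum_fourierCoeff_mul_chi {n : ℕ} (g : Cube n → ℝ) (y : Cube n) :
    ∑ S : Finset (Fin n), fourierCoeff g S * chi S y = g y := by
  have : ∀ S : Finset (Fin n), fourierCoeff g S * chi S y =
      ∑ x, g x / 2 ^ n * (chi S x * chi S y) := fun S => by
    rw [fourierCoeff, div_mul_eq_mul_div, Finset.sum_mul, Finset.sum_div]
    exact Finset.sum_congr rfl fun x _ => by ring
  simp_rw [this]
  rw [Finset.sum_comm]
  simp_rw [← Finset.mul_sum, sum_chi_mul_chi]
  simp

/-- Cauchy–Schwarz over the nonzero coefficients only. -/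
lemma sum_abs_fourierCoeff_le {n : ℕ} (g : Cube n → ℝ) (i : Fin n) :
    ∑ S : Finset (Fin n) with i ∈ S, |fourierCoeff g S| ≤ √(sparsity i g * influence i g) := by
  classical
  refine Real.le_sqrt_of_sq_le ?_
  let A : Finset (Finset (Fin n)) := Finset.univ.filter fun S => i ∈ S ∧ fourierCoeff g S ≠ 0
  have hA : sparsity i g = A.card := by
    rw [sparsity, ← Set.ncard_coe_finset]
    congr 1
    ext S; simp [A]
  have hsub : A ⊆ Finset.univ.filter fun S => i ∈ S := by
    intro S hS
    simp only [A, Finset.mem_filter] at hS ⊢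
    exact ⟨hS.1, hS.2.1⟩
  have hz : ∀ S ∈ Finset.univ.filter (fun S : Finset (Fin n) => i ∈ S), S ∉ A →
      fourierCoeff g S = 0 := by
    intro S hS hSA
    simp only [A, Finset.mem_filter, Finset.mem_univ, true_and, not_and, not_not] at hS hSA
    exact hSA hS
  have h1 : ∑ S : Finset (Fin n) with i ∈ S, |fourierCoeff g S| = ∑ S ∈ A, |fourierCoeff g S| :=
    (Finset.sum_subset hsub fun S hS hSA => by rw [hz S hS hSA, abs_zero]).symm
  have h2 : influence i g = ∑ S ∈ A, |fourierCoeff g S| ^ 2 := by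
    rw [influence]
    simp_rw [sq_abs]
    exact (Finset.sum_subset hsub fun S hS hSA => by rw [hz S hS hSA]; ring).symm
  rw [h1, h2, hA]
  exact sq_sum_le_card_mul_sum_sq

/-- Characters avoiding `i` cancel in the difference and the others change by at most 2. This factor
2 is absorbed by the halving of η in the hypothesis. -/
lemma abs_sub_le_of_eq_off {n : ℕ} (g : Cube n → ℝ) {x y : Cube n} {i : Fin n}
    (h : ∀ j, j ≠ i → x j = y j) : |g x - g y| ≤ 2 * √(sparsity i g * influence i g) := by
  classical
  rw [← sum_fourierCoeff_mul_chi g x, ← sum_fourierCoeff_mul_chi g y, ← Finset.sum_sub_distrib]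
  have h0 : ∑ S : Finset (Fin n), (fourierCoeff g S * chi S x - fourierCoeff g S * chi S y) =
      ∑ S : Finset (Fin n) with i ∈ S, fourierCoeff g S * (chi S x - chi S y) := by
    rw [Finset.sum_filter]
    refine Finset.sum_congr rfl fun S _ => ?_
    split_ifs with hi
    · ring
    · have : chi S x = chi S y := Finset.prod_congr rfl fun j hj => by
        rw [h j fun hji => hi (hji ▸ hj)]
      rw [this, sub_self]
  rw [h0]
  calc |∑ S : Finset (Fin n) with i ∈ S, fourierCoeff g S * (chi S x - chi S y)|
      ≤ ∑ S : Finset (Fin n) with i ∈ S, |fourierCoeff g S * (chi S x - chi S y)| :=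
        Finset.abs_sum_le_sum_abs _ _
    _ ≤ ∑ S : Finset (Fin n) with i ∈ S, 2 * |fourierCoeff g S| := by
        refine Finset.sum_le_sum fun S _ => ?_
        rw [abs_mul, mul_comm]
        refine mul_le_mul_of_nonneg_right ((abs_sub _ _).trans ?_) (abs_nonneg _)
        rw [abs_chi, abs_chi]; norm_num
    _ ≤ 2 * √(sparsity i g * influence i g) := by
        rw [← Finset.mul_sum]
        exact mul_le_mul_of_nonneg_left (sum_abs_fourierCoeff_le g i) two_pos.le

/-- A function that changes by at most `L` along each edge is `L`-Lipschitz on the cube. -/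
lemma abs_sub_le_hammingDist {n : ℕ} (g : Cube n → ℝ) {L : ℝ}
    (hL : ∀ x y i, (∀ j, j ≠ i → x j = y j) → |g x - g y| ≤ L) (k : ℕ) :
    ∀ x y : Cube n, hammingDist x y = k → |g x - g y| ≤ k * L := by
  induction k with
  | zero =>
    intro x y h
    rw [hammingDist_eq_zero.1 h]; simp
  | succ k ih =>
    intro x y h
    obtain ⟨i, hi⟩ : ∃ i, x i ≠ y i := Function.ne_iff.1 (hammingDist_ne_zero.1 (by omega))
    have hd : hammingDist (Function.update x i (y i)) y = k := by
      unfold hammingDist at h ⊢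
      have : (Finset.univ.filter fun j => Function.update x i (y i) j ≠ y j) =
          (Finset.univ.filter fun j => x j ≠ y j).erase i := by
        ext j
        by_cases hj : j = i
        · subst hj; simp
        · simp [hj]
      rw [this, Finset.card_erase_of_mem (by simp [hi]), h]
      rfl
    have h1 := ih _ _ hd
    have h2 := hL x (Function.update x i (y i)) i fun j hj => by simp [hj]
    have := abs_sub_le (g x) (g (Function.update x i (y i))) (g y)
    push_cast
    linarith

/-! ### The covering radius -/

lemma exists_mem_hammingDist_le_coveringRadius {n : ℕ} {X : Set (Cube n)} (hX : X.Nonempty)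
    (y : Cube n) : ∃ x ∈ X, hammingDist y x ≤ coveringRadius X := by
  have : Nonempty X := hX.to_subtype
  obtain ⟨x, hx⟩ := ciInf_mem fun x : X => hammingDist y (x : Cube n)
  refine ⟨x, x.2, ?_⟩
  have hx : hammingDist y (x : Cube n) = ⨅ x : X, hammingDist y (x : Cube n) := hx
  rw [hx]
  exact le_ciSup (f := fun y : Cube n => ⨅ x : X, hammingDist y (x : Cube n))
    (Set.finite_range _).bddAbove y

/-! ### Deterministic query complexity from an approximating polynomial -/

lemma abs_sgn (b : Bool) : |sgn b| = 1 := by cases b <;> simp [sgn]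

lemma detQuery_le {n : ℕ} {f : PartialFn n} (T : DecisionTree n)
    (hT : ∀ x b, f x = some b → T.eval x = b) : detQuery n f ≤ T.depth :=
  Nat.sInf_le ⟨T, rfl, hT⟩

lemma signFn_eq_of_approximates {n : ℕ} {p : MvPolynomial (Fin n) ℝ} {f : PartialFn n}
    (hp : Approximates p f) {x : Cube n} {b : Bool} (hx : f x = some b) :
    signFn (evalCube p) x = b := by
  have := abs_le.1 (hp x b hx)
  cases b
  · simp only [signFn, decide_eq_false_iff_not, not_lt]
    simp only [sgn] at this
    norm_num at this
    linarith
  · simp only [signFn, decide_eq_true_eq]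
    simp only [sgn] at this
    norm_num at this
    linarith

lemma detQuery_le_pow {n : ℕ} {f : PartialFn n} {p : MvPolynomial (Fin n) ℝ} {d B : ℕ} {ε : ℝ}
    (hp : Approximates p f) (hd : p.totalDegree ≤ d) (hε : 0 < ε)
    (hlow : ∀ x, ε ≤ |evalCube p x|) (hup : ∀ x, |evalCube p x| ≤ 2)
    (hB : 2 * (d : ℝ) ^ 2 ≤ B * ε) : detQuery n f ≤ B ^ 4 := by
  obtain ⟨T, hT, hTx⟩ := (blockSensitivityLE_signFn hd hε hlow hup hB).exists_tree
  exact (detQuery_le T fun x b hx => by rw [hTx, signFn_eq_of_approximates hp hx]).trans hT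

lemma Approximates.abs_bounds {n : ℕ} {p : MvPolynomial (Fin n) ℝ} {f : PartialFn n}
    (hp : Approximates p f) {x : Cube n} (hx : x ∈ Dom f) :
    2 / 3 ≤ |evalCube p x| ∧ |evalCube p x| ≤ 4 / 3 := by
  obtain ⟨b, hb⟩ := hx
  have h1 := hp x b hb
  have h2 := abs_sgn b
  have h3 := abs_sub_abs_le_abs_sub (evalCube p x) (sgn b)
  have h4 := abs_sub_abs_le_abs_sub (sgn b) (evalCube p x)
  rw [abs_sub_comm] at h4
  constructor <;> linarith

lemma detQuery_eq_zero_of_const {n : ℕ} {f : PartialFn n} {p : MvPolynomial (Fin n) ℝ}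
    (hp : Approximates p f) (hd : p.totalDegree = 0) : detQuery n f = 0 := by
  rw [MvPolynomial.totalDegree_eq_zero_iff_eq_C] at hd
  refine Nat.le_zero.1 (detQuery_le (.leaf (signFn (evalCube p) fun _ => false)) fun x b hx => ?_)
  rw [← signFn_eq_of_approximates hp hx, DecisionTree.eval, hd]
  simp [signFn, evalCube]

/-- `p` is bounded away from `0` on the whole cube if its edge differences are at most
`η(f, c)`. -/
lemma LowInfluence.exists_gap {n : ℕ} {f : PartialFn n} {c : ℝ}
    (hf : (Dom f).Nonempty) (h : LowInfluence f c) :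
    ∃ p : MvPolynomial (Fin n) ℝ, p.totalDegree ≤ approxDegree f ∧ Approximates p f ∧
      (∀ x, |evalCube p x| ≤ 2) ∧
      ∀ x, min (2 / 3) ((approxDegree f : ℝ) ^ (-c)) ≤ |evalCube p x| := by
  obtain ⟨p, ⟨-, hd, hp⟩, hinf⟩ := h
  refine ⟨p, hd, hp, ?_⟩
  have hmin1 := min_le_left (2 / 3) ((approxDegree f : ℝ) ^ (-c))
  have hmin2 := min_le_right (2 / 3) ((approxDegree f : ℝ) ^ (-c))
  have hpos : 0 ≤ (approxDegree f : ℝ) ^ (-c) := by positivity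
  set r := coveringRadius (Dom f) with hr
  set δ := (approxDegree f : ℝ) ^ (-c)
  by_cases hr0 : r = 0
  · have hall : ∀ y, y ∈ Dom f := by
      intro y
      obtain ⟨x, hx, hxy⟩ := exists_mem_hammingDist_le_coveringRadius hf y
      have : y = x := hammingDist_eq_zero.1 (by omega)
      exact this ▸ hx
    exact ⟨fun x => by linarith [(hp.abs_bounds (hall x)).2],
      fun x => by linarith [(hp.abs_bounds (hall x)).1]⟩
  · have hη : ∀ i : Fin n, 2 * √((sparsity i (evalCube p) : ℝ) * influence i (evalCube p)) ≤
        (2 / 3 - δ) / r := by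
      intro i
      have h := hinf i
      rw [eta, if_neg hr0] at h
      have h2 : ((((2 / 3 - δ) / r : ℝ) : EReal) / 2) = (((2 / 3 - δ) / r / 2 : ℝ) : EReal) := by
        rw [EReal.coe_div ((2 / 3 - δ) / r) 2]; rfl
      rw [h2, EReal.coe_le_coe_iff] at h
      linarith
    have hrpos : (0 : ℝ) < r := by exact_mod_cast Nat.pos_of_ne_zero hr0
    -- This yields |p| ≥ 2/3 - max(0, 2/3 - δ) = min(2/3, δ) and |p| ≤ 4/3 + 2/3.
    have key : ∀ y, ∃ x ∈ Dom f, |evalCube p y - evalCube p x| ≤ max 0 (2 / 3 - δ) := by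
      intro y
      obtain ⟨x, hx, hxy⟩ := exists_mem_hammingDist_le_coveringRadius hf y
      refine ⟨x, hx, ?_⟩
      by_cases hxy0 : hammingDist y x = 0
      · rw [hammingDist_eq_zero.1 hxy0]; simp
      · obtain ⟨i, -⟩ : ∃ i, y i ≠ x i := Function.ne_iff.1 (hammingDist_ne_zero.1 hxy0)
        -- The threshold dominates a square root at the index `i`, so it cannot be negative.
        have hη0 : 0 ≤ (2 / 3 - δ) / r := le_trans (by positivity) (hη i)
        have := abs_sub_le_hammingDist (evalCube p) (L := (2 / 3 - δ) / r)
          (fun x y i hxy => (abs_sub_le_of_eq_off _ hxy).trans (hη i)) _ y x rfl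
        refine this.trans (le_trans ?_ (le_max_right _ _))
        have hle : (hammingDist y x : ℝ) ≤ r := by exact_mod_cast hxy
        calc (hammingDist y x : ℝ) * ((2 / 3 - δ) / r) ≤ r * ((2 / 3 - δ) / r) :=
              mul_le_mul_of_nonneg_right hle hη0
          _ = 2 / 3 - δ := by field_simp
    constructor
    · intro y
      obtain ⟨x, hx, hxy⟩ := key y
      have h1 := (hp.abs_bounds hx).2
      have h2 := abs_sub_abs_le_abs_sub (evalCube p y) (evalCube p x)
      have h3 : max 0 (2 / 3 - δ) ≤ 2 / 3 := max_le (by norm_num) (by linarith)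
      linarith
    · intro y
      obtain ⟨x, hx, hxy⟩ := key y
      have h1 := (hp.abs_bounds hx).1
      have h2 := abs_sub_abs_le_abs_sub (evalCube p x) (evalCube p y)
      rw [abs_sub_comm] at h2
      rcases max_cases 0 (2 / 3 - δ) with h | h <;> linarith

lemma LowInfluence.detQuery_le {n : ℕ} {f : PartialFn n} {c : ℝ}
    (hf : (Dom f).Nonempty) (h : LowInfluence f c) :
    detQuery n f ≤ 81 * approxDegree f ^ (8 + 4 * ⌈c⌉₊) := by
  obtain ⟨p, hd, hp, hup, hlow⟩ := h.exists_gap hf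
  -- In degree 0 the power d⁻ᶜ may vanish and give no gap, but then `p` is constant.
  rcases Nat.eq_zero_or_pos (approxDegree f) with h0 | hpos
  · rw [detQuery_eq_zero_of_const hp (by omega)]
    exact Nat.zero_le _
  · set d := approxDegree f
    set m := ⌈c⌉₊
    have hd1 : (1 : ℝ) ≤ d := by exact_mod_cast hpos
    have hdm : (0 : ℝ) < (d : ℝ) ^ m := by positivity
    have hdm1 : (1 : ℝ) ≤ (d : ℝ) ^ m := one_le_pow₀ hd1
    have hε : 2 / 3 * ((d : ℝ) ^ m)⁻¹ ≤ min (2 / 3) ((d : ℝ) ^ (-c)) := by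
      have hinv : ((d : ℝ) ^ m)⁻¹ ≤ 1 := inv_le_one_of_one_le₀ hdm1
      refine le_min (by linarith) ?_
      have : ((d : ℝ) ^ m)⁻¹ ≤ (d : ℝ) ^ (-c) := by
        rw [← Real.rpow_natCast, ← Real.rpow_neg (by positivity)]
        exact Real.rpow_le_rpow_of_exponent_le hd1 (neg_le_neg (Nat.le_ceil c))
      have := inv_pos.2 hdm
      linarith
    -- With ε = (2/3) d⁻ᵐ this `B` gives Bε = 2d² exactly, and B⁴ = 81 d^(8 + 4m).
    have := detQuery_le_pow (B := 3 * d ^ (2 + m)) hp hd (by positivity)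
      (fun x => hε.trans (hlow x)) hup (by
        push_cast
        rw [pow_add]
        field_simp
        norm_num)
    refine this.trans (le_of_eq ?_)
    ring

/-! ### The polynomial method -/

/-- `g` is given on the cube by a polynomial of degree at most `d`. -/
def DegreeLE {n : ℕ} (d : ℕ) (g : Cube n → ℝ) : Prop :=
  ∃ p : MvPolynomial (Fin n) ℝ, p.totalDegree ≤ d ∧ ∀ x, evalCube p x = g x

namespace DegreeLE

variable {n : ℕ} {d e : ℕ} {g h : Cube n → ℝ}

lemma const (a : ℝ) (d : ℕ) : DegreeLE d (fun _ : Cube n => a) :=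
  ⟨MvPolynomial.C a, by simp, fun x => by simp [evalCube]⟩

lemma sgn_apply (i : Fin n) : DegreeLE 1 (fun x : Cube n => sgn (x i)) :=
  ⟨MvPolynomial.X i, by simp, fun x => by simp [evalCube]⟩

lemma mono (hg : DegreeLE d g) (hde : d ≤ e) : DegreeLE e g :=
  let ⟨p, hp, hpg⟩ := hg
  ⟨p, hp.trans hde, hpg⟩

lemma add (hg : DegreeLE d g) (hh : DegreeLE d h) : DegreeLE d (fun x => g x + h x) := by
  obtain ⟨p, hp, hpg⟩ := hg
  obtain ⟨q, hq, hqh⟩ := hh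
  refine ⟨p + q, (MvPolynomial.totalDegree_add _ _).trans (max_le hp hq), fun x => ?_⟩
  simp [← hpg, ← hqh, evalCube]

lemma mul (hg : DegreeLE d g) (hh : DegreeLE e h) : DegreeLE (d + e) (fun x => g x * h x) := by
  obtain ⟨p, hp, hpg⟩ := hg
  obtain ⟨q, hq, hqh⟩ := hh
  refine ⟨p * q, (MvPolynomial.totalDegree_mul _ _).trans (add_le_add hp hq), fun x => ?_⟩
  simp [← hpg, ← hqh, evalCube]

lemma const_mul (a : ℝ) (hg : DegreeLE d g) : DegreeLE d (fun x => a * g x) := by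
  simpa using (const a 0).mul hg

lemma sub (hg : DegreeLE d g) (hh : DegreeLE d h) : DegreeLE d (fun x => g x - h x) := by
  simpa [sub_eq_add_neg] using hg.add (hh.const_mul (-1))

lemma sum {κ : Type*} (s : Finset κ) {g : κ → Cube n → ℝ} (hg : ∀ i ∈ s, DegreeLE d (g i)) :
    DegreeLE d (fun x => ∑ i ∈ s, g i x) := by
  classical
  induction s using Finset.induction_on with
  | empty => simpa using const 0 d
  | insert j s hj ih =>
    simp_rw [Finset.sum_insert hj]
    exact (hg j (Finset.mem_insert_self _ _)).add
      (ih fun i hi => hg i (Finset.mem_insert_of_mem hi))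

/-- Interpolate between the two cases with (1 ± xᵢ)/2, which costs one degree per query. Addresses
beyond `n` always read 0 and cost nothing. -/
lemma select {φ : Bool → Cube n → ℝ} (hφ : ∀ b, DegreeLE d (φ b)) (b : Bool)
    (i : Fin (2 ^ Nat.clog 2 n)) : DegreeLE (d + 1) (fun x => φ (xor b (inputBit x i)) x) := by
  by_cases hi : (i : ℕ) < n
  · have hs := sgn_apply (⟨i, hi⟩ : Fin n)
    have h0 := (((const 1 1).add hs).const_mul (1 / 2)).mul (hφ b)
    have h1 := (((const 1 1).sub hs).const_mul (1 / 2)).mul (hφ (!b))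
    have := h0.add h1
    rw [add_comm 1 d] at this
    convert this using 2 with x
    cases hx : x ⟨i, hi⟩ <;> simp [inputBit, hi, hx, sgn] <;> ring
  · have : ∀ x : Cube n, inputBit x i = false := fun x => by simp [inputBit, hi]
    simp_rw [this, Bool.xor_false]
    exact (hφ b).mono (Nat.le_succ d)

end DegreeLE

variable {n w : ℕ}

lemma degreeLE_mulVec {d : ℕ} (A : Matrix (BasisState n w) (BasisState n w) ℂ)
    {ψ : Cube n → BasisState n w → ℂ}
    (hψ : ∀ s, DegreeLE d (fun x => (ψ x s).re) ∧ DegreeLE d (fun x => (ψ x s).im))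
    (s : BasisState n w) :
    DegreeLE d (fun x => (A.mulVec (ψ x) s).re) ∧ DegreeLE d (fun x => (A.mulVec (ψ x) s).im) := by
  simp only [Matrix.mulVec, dotProduct, Complex.re_sum, Complex.im_sum, Complex.mul_re,
    Complex.mul_im]
  exact ⟨DegreeLE.sum _ fun t _ => ((hψ t).1.const_mul _).sub ((hψ t).2.const_mul _),
    DegreeLE.sum _ fun t _ => ((hψ t).2.const_mul _).add ((hψ t).1.const_mul _)⟩

/-- After `q` queries the amplitudes are polynomials of degree at most `q` in the input. -/
lemma degreeLE_runState (U : ℕ → Matrix.unitaryGroup (BasisState n w) ℂ) (q : ℕ) :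
    ∀ s, DegreeLE q (fun x => (runState U x q s).re) ∧
      DegreeLE q (fun x => (runState U x q s).im) := by
  induction q with
  | zero => exact fun s => 
      ⟨DegreeLE.const (runState U (fun _ => false) 0 s).re 0,
        DegreeLE.const (runState U (fun _ => false) 0 s).im 0⟩
  | succ q ih =>
    refine degreeLE_mulVec _ fun s => ?_
    exact ⟨DegreeLE.select (φ := fun b x => (runState U x q (s.1, b, s.2.2)).re)
        (fun b => (ih _).1) s.2.1 s.1,
      DegreeLE.select (φ := fun b x => (runState U x q (s.1, b, s.2.2)).im)
        (fun b => (ih _).2) s.2.1 s.1⟩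

lemma degreeLE_outputProb (U : ℕ → Matrix.unitaryGroup (BasisState n w) ℂ) (q : ℕ) (b : Bool) :
    DegreeLE (2 * q) (fun x => outputProb (runState U x q) b) := by
  refine DegreeLE.sum _ fun s _ => ?_
  by_cases hs : s.2.1 = b
  · obtain ⟨h1, h2⟩ := degreeLE_runState U q s
    simp only [hs, if_true, Complex.sq_norm, Complex.normSq_apply]
    rw [two_mul]
    exact (h1.mul h1).add (h2.mul h2)
  · simp only [hs, if_false]
    exact DegreeLE.const 0 _

lemma sum_sq_norm_mulVec (A : Matrix.unitaryGroup (BasisState n w) ℂ) (ψ : BasisState n w → ℂ) :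
    ∑ s, ‖Matrix.mulVec (A : Matrix (BasisState n w) (BasisState n w) ℂ) ψ s‖ ^ 2 =
      ∑ s, ‖ψ s‖ ^ 2 := by
  have key : ∀ v : BasisState n w → ℂ, ((∑ s, ‖v s‖ ^ 2 : ℝ) : ℂ) = star v ⬝ᵥ v := by
    intro v
    simp [dotProduct, Complex.conj_mul']
  have hA : (A : Matrix (BasisState n w) (BasisState n w) ℂ).conjTranspose * A.1 = 1 :=
    Matrix.mem_unitaryGroup_iff'.1 A.2
  apply Complex.ofReal_injective
  rw [key, key, Matrix.star_mulVec, Matrix.dotProduct_mulVec, Matrix.vecMul_vecMul, hA,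
    Matrix.vecMul_one]

lemma sum_sq_norm_oracle (x : Cube n) (ψ : BasisState n w → ℂ) :
    ∑ s, ‖oracle x ψ s‖ ^ 2 = ∑ s, ‖ψ s‖ ^ 2 := by
  have hinv : Function.Involutive fun s : BasisState n w =>
      ((s.1, xor s.2.1 (inputBit x s.1), s.2.2) : BasisState n w) := by
    rintro ⟨i, b, z⟩
    simp
  exact Equiv.sum_comp (hinv.toPerm _) fun s => ‖ψ s‖ ^ 2

/-- The basis state `|0…0⟩`. -/
def zeroState (n w : ℕ) : BasisState n w := (⟨0, by positivity⟩, false, fun _ => false)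

lemma initState_eq_single : initState n w = Pi.single (zeroState n w) 1 := by
  funext s
  obtain ⟨i, b, z⟩ := s
  simp only [initState, zeroState, Pi.single_apply, Prod.mk.injEq]
  congr 2
  exact propext (Fin.ext_iff (b := ⟨0, by positivity⟩)).symm

lemma sum_sq_norm_runState (U : ℕ → Matrix.unitaryGroup (BasisState n w) ℂ) (x : Cube n) (q : ℕ) :
    ∑ s, ‖runState U x q s‖ ^ 2 = 1 := by
  induction q with
  | zero =>
    rw [runState, sum_sq_norm_mulVec, initState_eq_single]
    rw [Finset.sum_eq_single (zeroState n w)] <;> simp +contextual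
  | succ q ih => rw [runState, sum_sq_norm_mulVec, sum_sq_norm_oracle, ih]

lemma outputProb_nonneg (ψ : BasisState n w → ℂ) (b : Bool) : 0 ≤ outputProb ψ b :=
  Finset.sum_nonneg fun s _ => by split_ifs <;> positivity

lemma outputProb_add (ψ : BasisState n w → ℂ) :
    outputProb ψ false + outputProb ψ true = ∑ s, ‖ψ s‖ ^ 2 := by
  rw [outputProb, outputProb, ← Finset.sum_add_distrib]
  exact Finset.sum_congr rfl fun s _ => by cases s.2.1 <;> simp

/-! ### Bias amplification -/

/-- The cubic that amplifies the bias of a sign. -/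
def amplify (t : ℝ) : ℝ := 3 / 2 * t - 1 / 2 * (t * (t * t))

/-- The bounds come from 1 ∓ `amplify t` = (1 ∓ t)²(2 ± t)/2. -/
lemma abs_amplify_le_one {t : ℝ} (ht : |t| ≤ 1) : |amplify t| ≤ 1 := by
  obtain ⟨h1, h2⟩ := abs_le.1 ht
  rw [abs_le, amplify]
  constructor
  · nlinarith [mul_nonneg (sq_nonneg (1 + t)) (by linarith : 0 ≤ 2 - t)]
  · nlinarith [mul_nonneg (sq_nonneg (1 - t)) (by linarith : 0 ≤ 2 + t)]

lemma amplify_mono {s t : ℝ} (hs : 0 ≤ s) (hst : s ≤ t) (ht : t ≤ 1) : amplify s ≤ amplify t := by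
  unfold amplify
  have h3 : t * t + t * s + s * s ≤ 3 := by nlinarith
  nlinarith [mul_nonneg (sub_nonneg.2 hst) (sub_nonneg.2 h3)]

lemma amplify_neg (t : ℝ) : amplify (-t) = -amplify t := by unfold amplify; ring

/-- The iterates of 1/3 pass 4/9, 3/5 and 2/3. Two rounds reach only about 0.6664, just short. -/
lemma two_thirds_le_amplify {t : ℝ} (h : 1 / 3 ≤ t) (ht : t ≤ 1) :
    2 / 3 ≤ amplify (amplify (amplify t)) := by
  have hb : ∀ {s : ℝ}, 0 ≤ s → s ≤ 1 → amplify s ≤ 1 := fun h0 h1 =>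
    (le_abs_self _).trans (abs_amplify_le_one (abs_le.2 ⟨by linarith, h1⟩))
  have h1 : 4 / 9 ≤ amplify t := le_trans (by norm_num [amplify]) (amplify_mono (by norm_num) h ht)
  have h1' := hb (by linarith) ht
  have h2 : 3 / 5 ≤ amplify (amplify t) :=
    le_trans (by norm_num [amplify]) (amplify_mono (by norm_num) h1 h1')
  exact le_trans (by norm_num [amplify])
    (amplify_mono (by norm_num) h2 (hb (by linarith) h1'))

lemma DegreeLE.amplify {d : ℕ} {g : Cube n → ℝ} (hg : DegreeLE d g) :
    DegreeLE (3 * d) (fun x => QueryComplexity.amplify (g x)) := by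
  have h3 := (hg.mul (hg.mul hg)).mono (by omega : d + (d + d) ≤ 3 * d)
  exact ((hg.mono (by omega : d ≤ 3 * d)).const_mul _).sub (h3.const_mul _)

/-- The bias Pr[0] - Pr[1] has degree 2q and lies in [-1, 1] on every input, because the algorithm
also runs off the domain. Success probability 2/3 gives bias only 1/3, so three amplifications are
applied, each tripling the degree: 27 · 2 = 54. -/
lemma approxDegree_le_of_algorithm {f : PartialFn n} {q : ℕ}
    {U : ℕ → Matrix.unitaryGroup (BasisState n w) ℂ}
    (hU : ∀ x b, f x = some b → 2 / 3 ≤ outputProb (runState U x q) b) :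
    approxDegree f ≤ 54 * q := by
  let P : Cube n → ℝ := fun x =>
    outputProb (runState U x q) false - outputProb (runState U x q) true
  have hP : DegreeLE (2 * q) P := (degreeLE_outputProb U q false).sub (degreeLE_outputProb U q true)
  have hsum : ∀ x, outputProb (runState U x q) false + outputProb (runState U x q) true = 1 :=
    fun x => by rw [outputProb_add, sum_sq_norm_runState]
  have hP1 : ∀ x, |P x| ≤ 1 := fun x => by
    have h0 := outputProb_nonneg (runState U x q) false
    have h1 := outputProb_nonneg (runState U x q) true
    have := hsum x
    exact abs_le.2 ⟨by simp only [P]; linarith, by simp only [P]; linarith⟩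
  obtain ⟨p, hp, hpP⟩ := hP.amplify.amplify.amplify
  have hbound : ∀ x, |evalCube p x| ≤ 1 := fun x => by
    rw [hpP]
    exact abs_amplify_le_one (abs_amplify_le_one (abs_amplify_le_one (hP1 x)))
  suffices h : Approximates p f by
    have h' : approxDegree f ≤ p.totalDegree := Nat.sInf_le ⟨p, rfl, h, hbound⟩
    omega
  intro x b hx
  have h1 := hU x b hx
  have h2 := hsum x
  obtain ⟨h3, h4⟩ := abs_le.1 (hP1 x)
  obtain ⟨h5, h6⟩ := abs_le.1 (hbound x)
  cases b
  · have : 2 / 3 ≤ evalCube p x := by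
      rw [hpP]
      exact two_thirds_le_amplify (by simp only [P]; linarith) h4
    simp only [sgn]
    exact abs_le.2 ⟨by norm_num; linarith, by norm_num; linarith⟩
  · have : 2 / 3 ≤ -evalCube p x := by
      rw [hpP, ← amplify_neg, ← amplify_neg, ← amplify_neg]
      exact two_thirds_le_amplify (by simp only [P]; linarith) (by linarith)
    simp only [sgn]
    exact abs_le.2 ⟨by norm_num; linarith, by norm_num; linarith⟩

/-! ### Quantum simulation of decision trees -/

/-- A correspondence between two families of points extends to a permutation. -/
lemma exists_perm_of_eq_iff_eq {α σ : Type*} [Finite σ] (a b : α → σ)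
    (h : ∀ x y, a x = a y ↔ b x = b y) : ∃ π : Equiv.Perm σ, ∀ x, π (a x) = b x := by
  classical
  have := Fintype.ofFinite σ
  let φ : {s // s ∈ Set.range a} → {s // s ∈ Set.range b} := fun s => ⟨b s.2.choose, ⟨_, rfl⟩⟩
  have hφ : ∀ x, (φ ⟨a x, x, rfl⟩ : σ) = b x := fun x =>
    (h _ _).1 (Exists.choose_spec (⟨x, rfl⟩ : a x ∈ Set.range a))
  have hbij : Function.Bijective φ := by
    constructor
    · rintro ⟨_, x, rfl⟩ ⟨_, y, rfl⟩ hxy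
      have := congrArg Subtype.val hxy
      rw [hφ, hφ] at this
      exact Subtype.ext ((h _ _).2 this)
    · rintro ⟨_, y, rfl⟩
      exact ⟨⟨a y, y, rfl⟩, Subtype.ext (hφ y)⟩
  refine ⟨(Equiv.ofBijective φ hbij).extendSubtype, fun x => ?_⟩
  rw [Equiv.extendSubtype_apply_of_mem _ _ ⟨x, rfl⟩]
  exact hφ x

lemma exists_unitary_of_perm {σ : Type*} [Fintype σ] [DecidableEq σ] (π : Equiv.Perm σ) :
    ∃ U : Matrix.unitaryGroup σ ℂ, ∀ s, Matrix.mulVec (U : Matrix σ σ ℂ) (Pi.single s 1) =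
      Pi.single (π s) 1 := by
  -- A permutation matrix acts on vectors by precomposition, hence the inverse.
  refine ⟨⟨π⁻¹.permMatrix ℂ, ?_⟩, fun s => ?_⟩
  · rw [Matrix.mem_unitaryGroup_iff, Matrix.star_eq_conjTranspose, Matrix.conjTranspose_permMatrix,
      ← Matrix.permMatrix_mul]
    simp
  · rw [Matrix.permMatrix_mulVec]
    funext t
    simp [Pi.single_apply, Equiv.symm_apply_eq]

/-- The action of the oracle on basis states. -/
def oracleBasis (x : Cube n) (s : BasisState n w) : BasisState n w :=
  (s.1, xor s.2.1 (inputBit x s.1), s.2.2)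

lemma oracle_single (x : Cube n) (s : BasisState n w) :
    oracle x (Pi.single s 1) = Pi.single (oracleBasis x s) 1 := by
  funext t
  obtain ⟨i, b, z⟩ := t
  obtain ⟨j, c, y⟩ := s
  simp only [oracle, oracleBasis, Pi.single_apply, Prod.mk.injEq]
  congr 1
  refine propext (and_congr_right ?_)
  rintro rfl
  refine and_congr_left fun _ => ?_
  cases b <;> cases c <;> cases inputBit x i <;> simp

/-- A sequence of basis states in which each step reveals exactly what the oracle does is the run
of a quantum algorithm. -/
lemma exists_unitaries_of_basis_run (q : ℕ) (σ : ℕ → Cube n → BasisState n w)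
    (h0 : ∀ x y, σ 0 x = σ 0 y)
    (hstep : ∀ k < q, ∀ x y, oracleBasis x (σ k x) = oracleBasis y (σ k y) ↔
      σ (k + 1) x = σ (k + 1) y) :
    ∃ U : ℕ → Matrix.unitaryGroup (BasisState n w) ℂ,
      ∀ k ≤ q, ∀ x, runState U x k = Pi.single (σ k x) 1 := by
  obtain ⟨π₀, hπ₀⟩ := exists_perm_of_eq_iff_eq (fun _ : Cube n => zeroState n w) (σ 0)
    (by simpa using h0)
  obtain ⟨U₀, hU₀⟩ := exists_unitary_of_perm π₀
  have hU : ∀ k, ∃ U : Matrix.unitaryGroup (BasisState n w) ℂ, k < q → ∀ x,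
      Matrix.mulVec (U : Matrix (BasisState n w) (BasisState n w) ℂ)
        (Pi.single (oracleBasis x (σ k x)) 1) = Pi.single (σ (k + 1) x) 1 := by
    intro k
    by_cases hk : k < q
    · obtain ⟨π, hπ⟩ := exists_perm_of_eq_iff_eq _ _ (hstep k hk)
      obtain ⟨U, hU⟩ := exists_unitary_of_perm π
      exact ⟨U, fun _ x => by rw [hU, hπ]⟩
    · exact ⟨1, fun h => (hk h).elim⟩
  choose V hV using hU
  refine ⟨fun k => Nat.casesOn k U₀ V, fun k => ?_⟩
  induction k with
  | zero =>
    intro _ x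
    rw [runState, initState_eq_single]
    exact (hU₀ _).trans (by rw [hπ₀])
  | succ k ih =>
    intro hk x
    rw [runState, ih (by omega) x, oracle_single]
    exact hV k (by omega) x

lemma outputProb_single (s : BasisState n w) (b : Bool) :
    outputProb (Pi.single s 1) b = if s.2.1 = b then 1 else 0 := by
  rw [outputProb, Finset.sum_eq_single s]
  · simp
  · intro t _ hts
    simp [Pi.single_eq_of_ne hts]
  · simp

/-! ### Reversible simulation of a decision tree -/

namespace DecisionTree

/-- The address queried by the root. -/
def address : DecisionTree n → Fin (2 ^ Nat.clog 2 n)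
  -- A dummy query, whose answer `step` ignores; it pads short branches to the full depth.
  | .leaf _ => ⟨0, by positivity⟩
  | .node i _ _ => ⟨i, i.2.trans_le (Nat.le_pow_clog (by norm_num) n)⟩

/-- The subtree reached on an answer to the query at the root. -/
def step : DecisionTree n → Bool → DecisionTree n
  | .leaf b, _ => .leaf b
  | .node _ l r, b => if b then r else l

/-- The subtree reached after `k` queries. -/
def descend (T : DecisionTree n) (x : Cube n) : ℕ → DecisionTree n
  | 0 => T
  | k + 1 => (descend T x k).step (inputBit x (descend T x k).address)

/-- The `k`-th answer. -/
def answer (T : DecisionTree n) (x : Cube n) (k : ℕ) : Bool :=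
  inputBit x (T.descend x k).address

lemma eval_step (T : DecisionTree n) (x : Cube n) :
    (T.step (inputBit x T.address)).eval x = T.eval x := by
  cases T with
  | leaf b => rfl
  | node i l r => cases hx : x i <;> simp [step, address, inputBit, eval, hx]

lemma depth_step (T : DecisionTree n) (b : Bool) : (T.step b).depth ≤ T.depth - 1 := by
  cases T with
  | leaf b => simp [step, depth]
  | node i l r => cases b <;> simp [step, depth]

lemma eval_descend (T : DecisionTree n) (x : Cube n) (k : ℕ) :
    (T.descend x k).eval x = T.eval x := by
  induction k with
  | zero => rfl
  | succ k ih => rw [descend, eval_step, ih]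

lemma depth_descend (T : DecisionTree n) (x : Cube n) (k : ℕ) :
    (T.descend x k).depth ≤ T.depth - k := by
  induction k with
  | zero => simp [descend]
  | succ k ih =>
    rw [descend]
    exact (depth_step _ _).trans (by omega)

/-- The label of a leaf. -/
def label : DecisionTree n → Bool
  | .leaf b => b
  | .node _ _ _ => false

lemma label_descend_depth (T : DecisionTree n) (x : Cube n) :
    (T.descend x T.depth).label = T.eval x := by
  have h := T.depth_descend x T.depth
  rw [← T.eval_descend x T.depth]
  cases hT : T.descend x T.depth with
  | leaf b => rfl
  | node i l r => rw [hT, depth] at h; omega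

lemma descend_eq_of_answers_eq (T : DecisionTree n) (x y : Cube n) (k : ℕ)
    (h : ∀ j < k, T.answer x j = T.answer y j) : T.descend x k = T.descend y k := by
  induction k with
  | zero => rfl
  | succ k ih =>
    have h1 := ih fun j hj => h j (by omega)
    have h2 := h k (by omega)
    rw [answer, answer] at h2
    rw [descend, descend, h2, h1]

/-- The workspace after `k` queries. -/
def history (T : DecisionTree n) (x : Cube n) (k : ℕ) : Fin T.depth → Bool :=
  fun j => if (j : ℕ) < k then T.answer x j else false

lemma history_eq_iff (T : DecisionTree n) (x y : Cube n) {k : ℕ} (hk : k ≤ T.depth) :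
    T.history x k = T.history y k ↔ ∀ j < k, T.answer x j = T.answer y j := by
  constructor
  · intro h j hj
    simpa [history, hj] using congrFun h ⟨j, by omega⟩
  · intro h
    funext j
    by_cases hj : (j : ℕ) < k
    · simpa [history, hj] using h j hj
    · simp [history, hj]

/-- The basis state of the simulation after `k` queries. -/
def basisRun (T : DecisionTree n) (k : ℕ) (x : Cube n) : BasisState n T.depth :=
  -- The target is kept 0 until the end, so the oracle writes the bare answer into it; only the last
  -- state carries the output.
  ((T.descend x k).address, if k = T.depth then (T.descend x k).label else false, T.history x k)

/-- The stored answers determine the current subtree, hence the address and the target. -/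
lemma basisRun_eq_iff (T : DecisionTree n) (x y : Cube n) {k : ℕ} (hk : k ≤ T.depth) :
    T.basisRun k x = T.basisRun k y ↔ ∀ j < k, T.answer x j = T.answer y j := by
  rw [← history_eq_iff T x y hk]
  constructor
  · intro h
    exact congrArg (fun s => s.2.2) h
  · intro h
    rw [basisRun, basisRun, h,
      descend_eq_of_answers_eq T x y k ((history_eq_iff T x y hk).1 h)]

lemma oracleBasis_basisRun (T : DecisionTree n) (x : Cube n) {k : ℕ} (hk : k < T.depth) :
    oracleBasis x (T.basisRun k x) = ((T.descend x k).address, T.answer x k, T.history x k) := by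
  simp [oracleBasis, basisRun, answer, hk.ne]

lemma exists_algorithm (T : DecisionTree n) :
    ∃ U : ℕ → Matrix.unitaryGroup (BasisState n T.depth) ℂ,
      ∀ x, outputProb (runState U x T.depth) (T.eval x) = 1 := by
  obtain ⟨U, hU⟩ := exists_unitaries_of_basis_run T.depth T.basisRun
    (fun x y => (basisRun_eq_iff T x y (Nat.zero_le _)).2 (by simp)) (by
      intro k hk x y
      rw [basisRun_eq_iff T x y hk, oracleBasis_basisRun T x hk, oracleBasis_basisRun T y hk]
      -- After the oracle call, the history and the target together hold the first k + 1 answers,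
      -- exactly what the next state encodes; this makes the step reversible.
      simp only [Prod.mk.injEq, history_eq_iff T x y hk.le]
      constructor
      · rintro ⟨-, h1, h2⟩ j hj
        rcases Nat.lt_succ_iff_lt_or_eq.1 hj with hj | rfl
        · exact h2 j hj
        · exact h1
      · intro h
        have h' : ∀ j < k, T.answer x j = T.answer y j := fun j hj => h j (by omega)
        exact ⟨by rw [descend_eq_of_answers_eq T x y k h'], h k (by omega), h'⟩)
  refine ⟨U, fun x => ?_⟩
  rw [hU _ le_rfl, outputProb_single, if_pos]
  simp [basisRun, label_descend_depth]

end DecisionTree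

/-! ### The relation between the two measures -/

/-- The infimum is attained once some correct tree exists. One comes from any total extension, whose
block sensitivity is at most the number of all blocks. -/
lemma exists_tree_depth_eq_detQuery (f : PartialFn n) :
    ∃ T : DecisionTree n, T.depth = detQuery n f ∧ ∀ x b, f x = some b → T.eval x = b := by
  refine Nat.sInf_mem (s := {d | ∃ T : DecisionTree n, T.depth = d ∧
    ∀ x b, f x = some b → T.eval x = b}) ?_
  have hB : BlockSensitivityLE (fun x => (f x).getD false) (Fintype.card (Finset (Fin n))) :=
    fun _ 𝓑 _ _ => Finset.card_le_univ 𝓑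
  obtain ⟨T, -, hT⟩ := hB.exists_tree
  exact ⟨_, T, rfl, fun x b hx => by rw [hT, hx]; rfl⟩

lemma exists_algorithm_of_detQuery (f : PartialFn n) :
    ∃ (w : ℕ) (U : ℕ → Matrix.unitaryGroup (BasisState n w) ℂ),
      ∀ x b, f x = some b → 2 / 3 ≤ outputProb (runState U x (detQuery n f)) b := by
  obtain ⟨T, hTd, hT⟩ := exists_tree_depth_eq_detQuery f
  obtain ⟨U, hU⟩ := T.exists_algorithm
  refine ⟨T.depth, U, fun x b hx => ?_⟩
  rw [← hTd, ← hT x b hx, hU]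
  norm_num

lemma quantumQuery_le_detQuery (f : PartialFn n) : quantumQuery n f ≤ detQuery n f :=
  Nat.sInf_le (exists_algorithm_of_detQuery f)

lemma approxDegree_le_quantumQuery (f : PartialFn n) :
    approxDegree f ≤ 54 * quantumQuery n f := by
  obtain ⟨w, U, hU⟩ := Nat.sInf_mem (s := {q | ∃ (w : ℕ)
    (U : ℕ → Matrix.unitaryGroup (BasisState n w) ℂ),
    ∀ x b, f x = some b → 2 / 3 ≤ outputProb (runState U x q) b})
    ⟨_, exists_algorithm_of_detQuery f⟩
  exact approxDegree_le_of_algorithm hU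

end QueryComplexity

end

theorem mainTheorem7 (c : ℝ) (hc : 0 ≤ c) :
    QueryComplexity.PolyRelatedOn
      (fun n => {f : QueryComplexity.PartialFn n |
        (QueryComplexity.Dom f).Nonempty ∧ QueryComplexity.LowInfluence f c})
      QueryComplexity.detQuery QueryComplexity.quantumQuery := by
  refine ⟨81 * 54 ^ (8 + 4 * ⌈c⌉₊), 8 + 4 * ⌈c⌉₊, fun n f ⟨hf, h⟩ => ⟨?_, ?_⟩⟩
  · refine (h.detQuery_le hf).trans ?_
    rw [mul_assoc, ← mul_pow]
    exact Nat.mul_le_mul_left _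
      (Nat.pow_le_pow_left (QueryComplexity.approxDegree_le_quantumQuery f) _)
  · refine (QueryComplexity.quantumQuery_le_detQuery f).trans ?_
    -- The exponent is at least 8, so raising a natural number to it does not decrease it.
    exact (Nat.le_self_pow (by omega) _).trans (Nat.le_mul_of_pos_left _ (by positivity))
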